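/- Let $L$ be a separable linearly ordered compact space, i.e. a separable compact space whose topology is the order topology of a linear order on it. Let $\kappa$ be the weight of $L$ (the least cardinality of a base of its topology) and assume $2^\kappa>\mathfrak c$. Then there is a compactification $\gamma\omega$ of the countable discrete space $\omega$ whose remainder $\gamma\omega\setminus\omega$ is homeomorphic to $L$ and which is not tame, that is, the closed subspace $\{f\in C(\gamma\omega): f|_{\gamma\omega\setminus\omega}=0\}$ (the natural copy of $c_0$) is not complemented in the Banach space $C(\gamma\omega)$ of continuous real-valued functions. Hence there is a nontrivial twisted sum of $c_0$ and $C(L)$: a short exact sequence $0\to c_0\to X\to C(L)\to 0$ of Banach spaces and bounded linear operators in which the map $c_0\to X$ has no bounded linear left inverse. In particular, both conclusions hold for the double arrow space, i.e. for $L=([0,1]\times\{0\})\cup((0,1)\times\{1\})$ with the order topology of the lexicographic order. -/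

import Mathlib

open Set TopologicalSpace Cardinal
open scoped ZeroAtInfty

universe u v w

/-- The weight of a topological space: the least cardinality of a base of its topology. -/
noncomputable def topWeight (X : Type u) [TopologicalSpace X] : Cardinal.{u} :=
  sInf {c : Cardinal.{u} | ∃ B : Set (Set X), IsTopologicalBasis B ∧ #B = c}

/-- `ι : ℕ → γ` exhibits `γ` as a compactification of the countable discrete space `ω = ℕ`:
`γ` is compact Hausdorff and `ι` is a homeomorphic embedding with dense range
(`ℕ` carries the discrete topology). -/
structure IsOmegaCompactification {γ : Type u} [TopologicalSpace γ] (ι : ℕ → γ) : Prop where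
  compact : CompactSpace γ
  hausdorff : T2Space γ
  denseEmbedding : IsDenseEmbedding ι

/-- The remainder `γω \ ω`. -/
def omegaRemainder {γ : Type u} (ι : ℕ → γ) : Set γ := (range ι)ᶜ

/-- The natural copy of `c₀` in `C(γω)`: the continuous functions vanishing on the remainder. -/
def naturalCZero {γ : Type u} [TopologicalSpace γ] (ι : ℕ → γ) : Submodule ℝ C(γ, ℝ) where
  carrier := {f | ∀ x ∈ omegaRemainder ι, f x = 0}
  add_mem' := by
    intro f g hf hg x hx
    simp [hf x hx, hg x hx]
  zero_mem' := by
    intro x _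
    simp
  smul_mem' := by
    intro c f hf x hx
    simp [hf x hx]

/-- The compactification is tame if the natural copy of `c₀` in `C(γω)` is complemented,
that is, it is the range of a bounded linear projection. -/
def IsTameCompactification {γ : Type u} [TopologicalSpace γ] (ι : ℕ → γ) : Prop :=
  (naturalCZero ι).ClosedComplemented

/-- There is a non-tame compactification of `ω` whose remainder is homeomorphic to `L`. -/
def HasNonTameCompactification (L : Type u) [TopologicalSpace L] : Prop :=
  ∃ (γ : Type u) (_ : TopologicalSpace γ) (ι : ℕ → γ),
    IsOmegaCompactification ι ∧ Nonempty (omegaRemainder ι ≃ₜ L) ∧ ¬ IsTameCompactification ι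

/-- A twisted sum of `Z` and `Y`: a short exact sequence `0 → Z → X → Y → 0` of bounded linear
operators. -/
structure IsTwistedSum {Z : Type u} {X : Type v} {Y : Type w}
    [NormedAddCommGroup Z] [NormedSpace ℝ Z] [NormedAddCommGroup X] [NormedSpace ℝ X]
    [NormedAddCommGroup Y] [NormedSpace ℝ Y] (i : Z →L[ℝ] X) (q : X →L[ℝ] Y) : Prop where
  injective : Function.Injective i
  exact : Function.Exact i q
  surjective : Function.Surjective q

/-- There is a nontrivial twisted sum of the Banach spaces `Z` and `Y`: a short exact sequence
`0 → Z → X → Y → 0` with `X` a Banach space in which `Z → X` has no bounded linear left inverse. -/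
def HasNontrivialTwistedSum (Z : Type u) (Y : Type v)
    [NormedAddCommGroup Z] [NormedSpace ℝ Z] [NormedAddCommGroup Y] [NormedSpace ℝ Y] : Prop :=
  ∃ (X : Type v) (_ : NormedAddCommGroup X) (_ : NormedSpace ℝ X) (_ : CompleteSpace X)
    (i : Z →L[ℝ] X) (q : X →L[ℝ] Y),
    IsTwistedSum i q ∧ ¬ ∃ r : X →L[ℝ] Z, r.comp i = ContinuousLinearMap.id ℝ Z

/-- The points of the double arrow space `([0,1] × {0}) ∪ ((0,1) × {1})`: pairs `(pos, side)`
(`side = false` stands for `0` and `side = true` for `1`). -/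
@[ext]
structure DoubleArrow : Type where
  pos : ℝ
  side : Bool
  pos_mem : pos ∈ Icc (0 : ℝ) 1
  side_mem : side = true → pos ∈ Ioo (0 : ℝ) 1

/-- The lexicographic order on the double arrow space. -/
noncomputable instance DoubleArrow.instLinearOrder : LinearOrder DoubleArrow :=
  LinearOrder.lift' (fun p : DoubleArrow => (toLex (p.pos, p.side) : ℝ ×ₗ Bool)) (by
    intro p q h
    have h' : (p.pos, p.side) = (q.pos, q.side) := toLex.injective h
    exact DoubleArrow.ext (congrArg Prod.fst h') (congrArg Prod.snd h'))

/-- The double arrow space carries the order topology. -/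
noncomputable instance DoubleArrow.instTopologicalSpace : TopologicalSpace DoubleArrow :=
  Preorder.topology DoubleArrow

instance DoubleArrow.instOrderTopology : OrderTopology DoubleArrow := ⟨rfl⟩

theorem DoubleArrow.le_def (p q : DoubleArrow) : p ≤ q ↔
    p.pos < q.pos ∨ p.pos = q.pos ∧ p.side ≤ q.side :=
  Prod.Lex.le_iff

theorem DoubleArrow.exists_isLUB (s : Set DoubleArrow) : ∃ x, IsLUB s x := by
  rcases s.eq_empty_or_nonempty with rfl | ⟨p₀, hp₀⟩
  · refine ⟨⟨0, false, by simp, by simp⟩, by simp [upperBounds], ?_⟩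
    intro b _
    rw [DoubleArrow.le_def]
    rcases b.pos_mem.1.lt_or_eq with h | h
    · exact Or.inl h
    · exact Or.inr ⟨h, Bool.false_le _⟩
  · let f : DoubleArrow → ℝ := fun p => p.pos
    have hbdd : BddAbove (f '' s) := ⟨1, by rintro _ ⟨p, _, rfl⟩; exact p.pos_mem.2⟩
    have hle : ∀ p ∈ s, f p ≤ sSup (f '' s) := fun p hp => le_csSup hbdd ⟨p, hp, rfl⟩
    have hne : (f '' s).Nonempty := ⟨_, p₀, hp₀, rfl⟩
    have h1 : sSup (f '' s) ≤ 1 := csSup_le hne (by rintro _ ⟨p, _, rfl⟩; exact p.pos_mem.2)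
    have h0 : 0 ≤ sSup (f '' s) := p₀.pos_mem.1.trans (hle p₀ hp₀)
    by_cases h : ∃ p ∈ s, f p = sSup (f '' s) ∧ p.side = true
    · obtain ⟨p, hp, hpt, hp2⟩ := h
      refine ⟨p, fun r hr => ?_, fun b hb => hb hp⟩
      rw [DoubleArrow.le_def]
      rcases (hle r hr).lt_or_eq with h | h
      · exact Or.inl (h.trans_eq hpt.symm)
      · exact Or.inr ⟨h.trans hpt.symm, by rw [hp2]; exact Bool.le_true _⟩
    · push Not at h
      refine ⟨⟨sSup (f '' s), false, ⟨h0, h1⟩, by simp⟩, fun r hr => ?_, fun b hb => ?_⟩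
      · rw [DoubleArrow.le_def]
        rcases (hle r hr).lt_or_eq with h' | h'
        · exact Or.inl h'
        · refine Or.inr ⟨h', ?_⟩
          have := h r hr h'
          simp only [ne_eq, Bool.not_eq_true] at this
          rw [this]
      · have hb1 : sSup (f '' s) ≤ f b := by
          refine csSup_le hne ?_
          rintro _ ⟨p, hp, rfl⟩
          rcases (DoubleArrow.le_def p b).1 (hb hp) with h' | h'
          · exact h'.le
          · exact h'.1.le
        rw [DoubleArrow.le_def]
        rcases hb1.lt_or_eq with h' | h'
        · exact Or.inl h'
        · exact Or.inr ⟨h', Bool.false_le _⟩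

/-- The double arrow space is compact. -/
instance DoubleArrow.instCompactSpace : CompactSpace DoubleArrow := by
  classical
  choose S hS using DoubleArrow.exists_isLUB
  let _ : ConditionallyCompleteLinearOrder DoubleArrow :=
    { DoubleArrow.instLinearOrder, LinearOrder.toLattice with
      sSup := S
      sInf := fun s => S (lowerBounds s)
      isLUB_csSup := fun s _ _ => hS s
      isGLB_csInf := fun s _ _ => isLUB_lowerBounds.1 (hS (lowerBounds s))
      csSup_of_not_bddAbove := fun s hs => absurd ⟨S s, (hS s).1⟩ hs
      csInf_of_not_bddBelow := fun s hs =>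
        absurd ⟨_, (isLUB_lowerBounds.1 (hS (lowerBounds s))).1⟩ hs }
  refine ⟨?_⟩
  have : (univ : Set DoubleArrow) = Icc (S ∅) (S univ) := by
    ext x
    simp only [mem_univ, mem_Icc, true_iff]
    exact ⟨(hS ∅).2 (by simp), (hS univ).1 (mem_univ x)⟩
  rw [this]
  exact isCompact_Icc

/-! ### Compactifications of ω with remainder `L`, one for each set of missed jumps. -/

section Splitting

open Filter Topology

variable {L : Type u}

/-! A counting argument. Let `r` be a dense sequence in `L` taking each of its values infinitely
often, and let J be the set `missedJumps r`. For a ∈ J the records of `r` below a form an infinite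
set of indices along which `r` increases to a. For every S ⊆ J one compactifies ω by letting n
follow `r n`, except that the records below each a ∈ S are diverted to the successor of a. The
remainder is always `L`, while `cut r S a` is a clopen set with trace {x ≤ a} on `L` whose trace on
ω tells, modulo finite sets, whether a ∈ S.

If P is a projection onto the natural copy of c₀, then Q = 1 - P kills the functions vanishing on
`L`, and Qf - f is null along ω. On `L` the indicators of the cuts increase with a and stay in
[0,1], so a ↦ Q(1_cut a)(n) has bounded variation for each n
(`boundedVariationOn_of_monotone_on_omegaRemainder`). The sequence of these functions determines S.
Since J carries at most 𝔠 functions of bounded variation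
(`Cardinal.mk_boundedVariationOn_le_continuum`), there are at most 𝔠 such sequences, so tameness for
every S would force 2^|J| ≤ 𝔠. But the weight of `L` is at most max(ℵ₀, |J|)
(`topWeight_le_max_mk_missedJumps`), so 2^|J| > 𝔠.

The twisted sum comes from restricting functions to the remainder. -/

theorem DenseRange.mem_range_of_isOpen_singleton [TopologicalSpace L] {r : ℕ → L} {x : L}
    (hr : DenseRange r) (h : IsOpen ({x} : Set L)) : x ∈ range r := by
  obtain ⟨n, hn⟩ := hr.exists_mem_open h ⟨x, rfl⟩
  exact ⟨n, hn⟩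

/-! ### Running maxima below a missed jump. -/

section Records

variable [LinearOrder L]

/-- The left endpoints of the jumps of `L` which are not values of `r`. -/
def missedJumps (r : ℕ → L) : Set L := {a | a ∉ range r ∧ ∃ b, a ⋖ b}

/-- The indices at which the sequence `r`, restricted to its values below `a`, attains a strict
running maximum. -/
def recordsBelow (r : ℕ → L) (a : L) : Set ℕ := {n | r n < a ∧ ∀ m < n, r m < a → r m < r n}

variable [TopologicalSpace L] [OrderTopology L] {r : ℕ → L} {a b x y : L}

theorem DenseRange.exists_between_of_not_covBy (hr : DenseRange r) (hxy : x < y) (h : ¬ x ⋖ y) :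
    ∃ n, x < r n ∧ r n < y := by
  obtain ⟨z, hz⟩ := exists_lt_lt_of_not_covBy hxy h
  exact hr.exists_mem_open isOpen_Ioo ⟨z, hz⟩

theorem DenseRange.exists_lt_of_mem_missedJumps (hr : DenseRange r) (ha : a ∈ missedJumps r) :
    ∃ y, y < a := by
  by_contra! h
  obtain ⟨ha, b, hab⟩ := ha
  refine ha (hr.mem_range_of_isOpen_singleton ?_)
  have : ({a} : Set L) = Iio b := by
    ext z
    exact ⟨fun hz => hz ▸ hab.lt, fun hz => le_antisymm (hab.le_of_lt hz) (h z)⟩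
  exact this ▸ isOpen_Iio

/-- A point with both a predecessor and a successor is isolated, hence a value of any dense
sequence. So values of `r` accumulate at a missed jump from below. -/
theorem DenseRange.not_covBy_of_mem_missedJumps (hr : DenseRange r) (ha : a ∈ missedJumps r) :
    ¬ y ⋖ a := by
  intro h
  obtain ⟨ha, b, hab⟩ := ha
  refine ha (hr.mem_range_of_isOpen_singleton ?_)
  have : ({a} : Set L) = Ioo y b := by
    ext z
    exact ⟨fun hz => hz ▸ ⟨h.lt, hab.lt⟩, fun hz => le_antisymm (hab.le_of_lt hz.2)
      (h.ge_of_gt hz.1)⟩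
  exact this ▸ isOpen_Ioo

theorem DenseRange.exists_between_of_mem_missedJumps (hr : DenseRange r) (ha : a ∈ missedJumps r)
    (hy : y < a) : ∃ n, y < r n ∧ r n < a :=
  hr.exists_between_of_not_covBy hy (hr.not_covBy_of_mem_missedJumps ha)

/-- Once `r` has taken a value in (y, a), every later record exceeds it. Thus `r` converges to `a`
along the records. -/
theorem finite_recordsBelow_le (hr : DenseRange r) (ha : a ∈ missedJumps r) (hy : y < a) :
    {n | n ∈ recordsBelow r a ∧ r n ≤ y}.Finite := by
  obtain ⟨m, hym, hma⟩ := hr.exists_between_of_mem_missedJumps ha hy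
  refine (finite_Iic m).subset fun n hn => ?_
  by_contra hmn
  exact absurd (hn.1.2 m (not_le.1 hmn) hma) (not_lt.2 (hn.2.trans hym.le))

theorem infinite_recordsBelow (hr : DenseRange r) (ha : a ∈ missedJumps r) :
    (recordsBelow r a).Infinite := by
  classical
  refine infinite_of_forall_exists_gt fun N => ?_
  have key : ∀ N : ℕ, ∃ y < a, ∀ m < N, r m < a → r m ≤ y := by
    intro N
    induction N with
    | zero =>
      obtain ⟨y, hy⟩ := hr.exists_lt_of_mem_missedJumps ha
      exact ⟨y, hy, by simp⟩
    | succ N ih =>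
      obtain ⟨y, hy, h⟩ := ih
      by_cases hN : r N < a
      · refine ⟨max y (r N), max_lt hy hN, fun m hm hma => ?_⟩
        rcases Nat.lt_succ_iff_lt_or_eq.1 hm with hm | rfl
        · exact (h m hm hma).trans (le_max_left _ _)
        · exact le_max_right _ _
      · refine ⟨y, hy, fun m hm hma => ?_⟩
        rcases Nat.lt_succ_iff_lt_or_eq.1 hm with hm | rfl
        · exact h m hm hma
        · exact absurd hma hN
  -- As y bounds the values below a at the indices 0, …, N, the first index with value in (y, a) is
  -- a record beyond N.
  obtain ⟨y, hy, h⟩ := key (N + 1)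
  have hex := hr.exists_between_of_mem_missedJumps ha hy
  have hs := Nat.find_spec hex
  refine ⟨Nat.find hex, ⟨hs.2, fun m hm hma => ?_⟩, ?_⟩
  · have := Nat.find_min hex hm
    push Not at this
    by_contra hlt
    exact absurd (this (hs.1.trans_le (not_lt.1 hlt))) (not_le.2 hma)
  · by_contra hN
    exact absurd (h _ (by omega) hs.2) (not_le.2 hs.1)

end Records

/-- The disjoint union of `ℕ` and `L`, topologized so that `n : ℕ` is close to `r n`, except that
the records of `r` below a point `a` of `S` are close to the successor of `a`. -/
def ShiftedSum (_r : ℕ → L) (_S : Set L) : Type u := ℕ ⊕ L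

/-! ### Topology of the shifted sum. -/

namespace ShiftedSum

variable {r : ℕ → L} {S : Set L}

/-- The inclusion of `ℕ`. -/
def nat (n : ℕ) : ShiftedSum r S := Sum.inl n

/-- The inclusion of `L`. -/
def pt (x : L) : ShiftedSum r S := Sum.inr x

theorem nat_injective : Function.Injective (nat : ℕ → ShiftedSum r S) := Sum.inl_injective

theorem pt_injective : Function.Injective (pt : L → ShiftedSum r S) := Sum.inr_injective

theorem nat_ne_pt (n : ℕ) (x : L) : (nat n : ShiftedSum r S) ≠ pt x := Sum.inl_ne_inr

theorem cases (z : ShiftedSum r S) : (∃ n, z = nat n) ∨ ∃ x, z = pt x := by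
  rcases z with n | x
  · exact Or.inl ⟨n, rfl⟩
  · exact Or.inr ⟨x, rfl⟩

/-- The subset of `ShiftedSum r S` with prescribed traces on `ℕ` and on `L`. -/
def glue (A : Set ℕ) (V : Set L) : Set (ShiftedSum r S) := {z | Sum.elim A V z}

@[simp] theorem nat_mem_glue {A : Set ℕ} {V : Set L} {n : ℕ} :
    (nat n : ShiftedSum r S) ∈ glue A V ↔ n ∈ A := Iff.rfl

@[simp] theorem pt_mem_glue {A : Set ℕ} {V : Set L} {x : L} :
    (pt x : ShiftedSum r S) ∈ glue A V ↔ x ∈ V := Iff.rfl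

theorem glue_compl (A : Set ℕ) (V : Set L) :
    (glue A V : Set (ShiftedSum r S))ᶜ = glue Aᶜ Vᶜ := by
  ext z
  rcases cases z with ⟨n, rfl⟩ | ⟨x, rfl⟩ <;> simp

theorem compl_range_nat : (range (nat : ℕ → ShiftedSum r S))ᶜ = range pt := by
  ext z
  rcases cases z with ⟨n, rfl⟩ | ⟨x, rfl⟩
  · simp [fun x => (nat_ne_pt (r := r) (S := S) n x).symm]
  · simp [nat_ne_pt]

variable [LinearOrder L] [TopologicalSpace L]

/-- The trace on `ℕ` of the neighbourhoods of `x : L`. -/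
def trace (r : ℕ → L) (S : Set L) (x : L) : Filter ℕ :=
  (comap r (𝓝 x) ⊓ cofinite ⊓ 𝓟 {n | x ∈ S → n ∉ recordsBelow r x}) ⊔
    (cofinite ⊓ 𝓟 {n | ∃ a ∈ S, a ⋖ x ∧ n ∈ recordsBelow r a})

/-- Points of `ℕ` impose no condition, so they are isolated; the axioms use only that each `trace r
S x` is a filter. -/
instance : TopologicalSpace (ShiftedSum r S) where
  IsOpen U := IsOpen (pt ⁻¹' U) ∧ ∀ x, pt x ∈ U → nat ⁻¹' U ∈ trace r S x
  isOpen_univ := by simp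
  isOpen_inter U V hU hV :=
    ⟨hU.1.inter hV.1, fun x hx => inter_mem (hU.2 x hx.1) (hV.2 x hx.2)⟩
  isOpen_sUnion s hs := by
    refine ⟨?_, ?_⟩
    · rw [preimage_sUnion]
      exact isOpen_biUnion fun U hU => (hs U hU).1
    · rintro x ⟨U, hU, hx⟩
      exact mem_of_superset ((hs U hU).2 x hx) (preimage_mono (subset_sUnion_of_mem hU))

theorem isOpen_iff {U : Set (ShiftedSum r S)} :
    IsOpen U ↔ IsOpen (pt ⁻¹' U) ∧ ∀ x, pt x ∈ U → nat ⁻¹' U ∈ trace r S x := Iff.rfl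

theorem isOpen_glue {A : Set ℕ} {V : Set L} :
    IsOpen (glue A V : Set (ShiftedSum r S)) ↔ IsOpen V ∧ ∀ x ∈ V, A ∈ trace r S x := Iff.rfl

theorem mem_trace {A : Set ℕ} {x : L} :
    A ∈ trace r S x ↔
      (∃ V ∈ 𝓝 x, {n | r n ∈ V ∧ (x ∈ S → n ∉ recordsBelow r x) ∧ n ∉ A}.Finite) ∧
        ∀ a ∈ S, a ⋖ x → {n | n ∈ recordsBelow r a ∧ n ∉ A}.Finite := by
  rw [trace, mem_sup]
  refine and_congr ?_ ?_
  · rw [mem_inf_principal, inf_comm, mem_inf_iff_superset]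
    constructor
    · rintro ⟨t, ht, s, ⟨V, hV, hVs⟩, h⟩
      refine ⟨V, hV, (mem_cofinite.1 ht).subset fun n hn hnt => ?_⟩
      exact hn.2.2 (h ⟨hnt, hVs hn.1⟩ hn.2.1)
    · rintro ⟨V, hV, hfin⟩
      refine ⟨_, hfin.compl_mem_cofinite, r ⁻¹' V, preimage_mem_comap hV, ?_⟩
      intro n hn h
      by_contra hA
      exact hn.1 ⟨hn.2, h, hA⟩
  · rw [mem_inf_principal, mem_cofinite]
    constructor
    · intro h a ha hax
      refine h.subset fun n hn => ?_
      simp only [mem_compl_iff, mem_ofPred_eq, not_forall]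
      exact ⟨⟨a, ha, hax, hn.1⟩, hn.2⟩
    · intro h
      by_cases hx : ∃ a ∈ S, a ⋖ x
      · obtain ⟨a, ha, hax⟩ := hx
        refine (h a ha hax).subset fun n hn => ?_
        simp only [mem_compl_iff, mem_ofPred_eq, not_forall] at hn
        obtain ⟨⟨a', _, ha'x, hn⟩, hA⟩ := hn
        -- A point has at most one predecessor, so only one set of records is diverted to it and a
        -- single finite exceptional set suffices.
        obtain rfl : a = a' := hax.unique_left ha'x
        exact ⟨hn, hA⟩
      · convert finite_empty
        ext n
        simp only [mem_compl_iff, mem_ofPred_eq, not_forall, mem_empty_iff_false, iff_false]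
        rintro ⟨⟨a, ha, hax, -⟩, -⟩
        exact hx ⟨a, ha, hax⟩

theorem trace_le_cofinite (x : L) : trace r S x ≤ cofinite :=
  sup_le (inf_le_left.trans inf_le_right) inf_le_left

theorem isOpen_singleton_nat (n : ℕ) : IsOpen ({nat n} : Set (ShiftedSum r S)) := by
  refine isOpen_iff.2 ⟨?_, fun x hx => absurd hx.symm (nat_ne_pt n x)⟩
  convert isOpen_empty
  ext x
  simp [(nat_ne_pt n x).symm]

theorem isClosed_singleton_nat (n : ℕ) : IsClosed ({nat n} : Set (ShiftedSum r S)) := by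
  refine ⟨isOpen_iff.2 ⟨?_, fun x _ => trace_le_cofinite x ?_⟩⟩
  · convert isOpen_univ
    ext x
    simp [(nat_ne_pt n x).symm]
  · rw [mem_cofinite]
    refine (finite_singleton n).subset fun m hm => ?_
    simpa [nat_injective.eq_iff] using hm

theorem continuous_pt : Continuous (pt : L → ShiftedSum r S) := ⟨fun _ hU => hU.1⟩

theorem isOpenEmbedding_nat : Topology.IsOpenEmbedding (nat : ℕ → ShiftedSum r S) := by
  refine .of_continuous_injective_isOpenMap continuous_of_discreteTopology nat_injective ?_
  intro A _
  rw [← biUnion_of_singleton A, image_iUnion₂]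
  exact isOpen_biUnion fun n _ => by simpa using isOpen_singleton_nat n

/-- An open set meeting `L` contains some `r n`. No value of `r` lies in `S`, so no record is
diverted away from it, and the infinitely many indices with that value reach it. -/
theorem denseRange_nat (hr : DenseRange r) (hinf : ∀ n, {m | r m = r n}.Infinite)
    (hS : S ⊆ missedJumps r) : DenseRange (nat : ℕ → ShiftedSum r S) := by
  refine dense_iff_inter_open.2 fun U hU hne => ?_
  obtain ⟨z, hz⟩ := hne
  rcases cases z with ⟨n, rfl⟩ | ⟨x, rfl⟩
  · exact ⟨nat n, hz, n, rfl⟩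
  · obtain ⟨n, hn⟩ := hr.exists_mem_open hU.1 ⟨x, hz⟩
    obtain ⟨⟨V, hV, hfin⟩, -⟩ := mem_trace.1 (hU.2 _ hn)
    obtain ⟨m, hm, hm'⟩ := ((hinf n).sdiff hfin).nonempty
    refine ⟨nat m, ?_, m, rfl⟩
    by_contra hmU
    refine hm' ⟨?_, fun h => absurd ⟨n, rfl⟩ (hS h).1, hmU⟩
    rw [show r m = r n from hm]
    exact mem_of_mem_nhds hV

/-- A free ultrafilter on `ℕ` has a limit x along `r`. It converges to x in the shifted sum, unless
x ∈ S and it contains the records below x; then it converges to the successor of x. -/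
theorem compactSpace [CompactSpace L] (hS : S ⊆ missedJumps r) : CompactSpace (ShiftedSum r S) := by
  refine ⟨isCompact_iff_ultrafilter_le_nhds.2 fun G _ => ?_⟩
  by_cases hG : range (pt : L → ShiftedSum r S) ∈ G
  · obtain ⟨x, -, hx⟩ := (isCompact_range continuous_pt).ultrafilter_le_nhds G (by simpa using hG)
    exact ⟨x, mem_univ _, hx⟩
  rw [← Ultrafilter.compl_mem_iff_notMem, ← compl_range_nat, compl_compl] at hG
  obtain ⟨G', hG'⟩ : ∃ G' : Ultrafilter ℕ, G'.map nat = G :=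
    ⟨G.comap nat_injective hG, Ultrafilter.coe_injective (by
      rw [Ultrafilter.coe_map, Ultrafilter.coe_comap, map_comap_of_mem hG])⟩
  subst hG'
  rcases G'.le_cofinite_or_eq_pure with hc | ⟨n, rfl⟩
  swap
  · exact ⟨nat n, mem_univ _, by simpa using pure_le_nhds _⟩
  have hlim : ∀ x, (G' : Filter ℕ) ≤ trace r S x →
      ((G'.map nat : Ultrafilter (ShiftedSum r S)) : Filter (ShiftedSum r S)) ≤ 𝓝 (pt x : ShiftedSum r S) := fun x hx =>
    by
    refine le_nhds_iff.2 fun U hxU hU => ?_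
    exact Ultrafilter.mem_coe.2 (Ultrafilter.mem_map.2 (hx (hU.2 x hxU)))
  obtain ⟨x, -, hx⟩ := isCompact_univ.ultrafilter_le_nhds (G'.map r) (by simp)
  have hx' : (G' : Filter ℕ) ≤ comap r (𝓝 x) := map_le_iff_le_comap.1 hx
  by_cases hxS : x ∈ S ∧ recordsBelow r x ∈ G'
  · obtain ⟨-, b, hb⟩ := hS hxS.1
    refine ⟨pt b, mem_univ _, hlim b (le_sup_of_le_right (le_inf hc ?_))⟩
    exact le_principal_iff.2 (mem_of_superset hxS.2 fun n hn => ⟨x, hxS.1, hb, hn⟩)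
  · refine ⟨pt x, mem_univ _, hlim x (le_sup_of_le_left (le_inf (le_inf hx' hc) ?_))⟩
    rw [le_principal_iff]
    by_cases h : x ∈ S
    · have : recordsBelow r x ∉ G' := fun h' => hxS ⟨h, h'⟩
      filter_upwards [Ultrafilter.compl_mem_iff_notMem.2 this] with n hn _ using hn
    · exact univ_mem' fun n h' => absurd h' h

variable [OrderTopology L]

/-- The initial segment of `ShiftedSum r S` determined by the left endpoint `a` of a jump. -/
def cut (r : ℕ → L) (S : Set L) (a : L) : Set (ShiftedSum r S) :=
  glue {n | r n ≤ a ∧ (a ∈ S → n ∉ recordsBelow r a)} (Iic a)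

/-- The records below a ∈ S tend to the successor of a, so they must be left out of the cut. For any
other a' ∈ S, the records below a' lie on the side of a' up to a finite set. -/
theorem isClopen_cut (hr : DenseRange r) (hS : S ⊆ missedJumps r) {a b : L} (hab : a ⋖ b) :
    IsClopen (cut r S a) := by
  have hV : (Iic a : Set L) = Iio b := by
    ext z
    exact ⟨fun h => lt_of_le_of_lt h hab.lt, fun h => hab.le_of_lt h⟩
  have hVo : IsOpen (Iic a : Set L) := hV ▸ isOpen_Iio
  refine ⟨⟨?_⟩, ?_⟩
  · rw [cut, glue_compl, isOpen_glue]
    refine ⟨isClosed_Iic.isOpen_compl, fun x hx => mem_trace.2 ⟨⟨Ioi a, ?_, ?_⟩, ?_⟩⟩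
    · exact Ioi_mem_nhds (not_le.1 hx)
    · convert finite_empty
      ext n
      simp only [mem_ofPred_eq, mem_compl_iff, not_not, mem_empty_iff_false, iff_false]
      exact fun h => absurd h.2.2.1 (not_le.2 h.1)
    · intro a' ha' hcov
      rcases lt_trichotomy a a' with h | rfl | h
      · refine (finite_recordsBelow_le hr (hS ha') h).subset fun n hn => ⟨hn.1, ?_⟩
        have := hn.2
        simp only [mem_compl_iff, not_not] at this
        exact this.1
      · convert finite_empty
        ext n
        simp only [mem_ofPred_eq, mem_compl_iff, not_not, mem_empty_iff_false, iff_false]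
        exact fun h => h.2.2 ha' h.1
      · exact absurd (not_le.1 hx) (hcov.2 h)
  · rw [cut, isOpen_glue]
    refine ⟨hVo, fun x hx => mem_trace.2 ⟨?_, ?_⟩⟩
    · by_cases haS : a ∈ S
      · rcases (mem_Iic.1 hx).lt_or_eq with h | rfl
        -- A value `r m` strictly between x and a bounds a neighbourhood of x that contains only
        -- finitely many of the omitted records.
        · obtain ⟨m, hm, hma⟩ := hr.exists_between_of_mem_missedJumps (hS haS) h
          refine ⟨Iio (r m), Iio_mem_nhds hm,
            (finite_recordsBelow_le hr (hS haS) hma).subset fun n hn => ⟨?_, hn.1.le⟩⟩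
          by_contra h'
          exact hn.2.2 ⟨(hn.1.trans hma).le, fun _ => h'⟩
        · refine ⟨Iic x, hVo.mem_nhds hx, ?_⟩
          convert finite_empty
          ext n
          simp only [mem_ofPred_eq, mem_empty_iff_false, iff_false]
          exact fun h => h.2.2 ⟨h.1, h.2.1⟩
      · refine ⟨Iic a, hVo.mem_nhds hx, ?_⟩
        convert finite_empty
        ext n
        simp only [mem_ofPred_eq, mem_empty_iff_false, iff_false]
        exact fun h => h.2.2 ⟨h.1, fun h' => absurd h' haS⟩
    · intro a' ha' hcov
      have hlt : a' < a := hcov.lt.trans_le hx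
      by_cases haS : a ∈ S
      · refine (finite_recordsBelow_le hr (hS haS) hlt).subset fun n hn => ⟨?_, hn.1.1.le⟩
        by_contra h'
        exact hn.2 ⟨(hn.1.1.trans hlt).le, fun _ => h'⟩
      · convert finite_empty
        ext n
        simp only [mem_ofPred_eq, mem_empty_iff_false, iff_false]
        exact fun h => h.2 ⟨(h.1.1.trans hlt).le, fun h' => absurd h' haS⟩

/-- Two points of `L` are separated by a cut if they form a jump, and otherwise by the two open rays
at a value of `r` between them. -/
theorem t2Space (hr : DenseRange r) (hS : S ⊆ missedJumps r) : T2Space (ShiftedSum r S) := by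
  have hnat : ∀ (n : ℕ) (z : ShiftedSum r S), nat n ≠ z →
      ∃ u v : Set (ShiftedSum r S), IsOpen u ∧ IsOpen v ∧ nat n ∈ u ∧ z ∈ v ∧ Disjoint u v :=
    fun n z hz => ⟨{nat n}, {nat n}ᶜ, isOpen_singleton_nat n,
      (isClosed_singleton_nat n).isOpen_compl, rfl, fun h => hz h.symm, disjoint_compl_right⟩
  have hpt : ∀ x y : L, x < y → ∃ u v : Set (ShiftedSum r S),
      IsOpen u ∧ IsOpen v ∧ pt x ∈ u ∧ pt y ∈ v ∧ Disjoint u v := by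
    intro x y hxy
    by_cases hcov : x ⋖ y
    · have h := isClopen_cut hr hS hcov
      exact ⟨cut r S x, (cut r S x)ᶜ, h.2, h.1.isOpen_compl, le_refl x, not_le.2 hxy,
        disjoint_compl_right⟩
    · obtain ⟨m, hxm, hmy⟩ := hr.exists_between_of_not_covBy hxy hcov
      refine ⟨glue (r ⁻¹' Iio (r m)) (Iio (r m)), glue (r ⁻¹' Ioi (r m)) (Ioi (r m)),
        isOpen_glue.2 ⟨isOpen_Iio, fun z hz => mem_trace.2 ⟨⟨_, Iio_mem_nhds hz, ?_⟩, ?_⟩⟩,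
        isOpen_glue.2 ⟨isOpen_Ioi, fun z hz => mem_trace.2 ⟨⟨_, Ioi_mem_nhds hz, ?_⟩, ?_⟩⟩,
        hxm, hmy, ?_⟩
      · convert finite_empty
        ext n
        simp only [mem_ofPred_eq, mem_empty_iff_false, iff_false]
        exact fun h => h.2.2 h.1
      · intro a ha haz
        convert finite_empty
        ext n
        simp only [mem_ofPred_eq, mem_empty_iff_false, iff_false]
        exact fun h => h.2 ((h.1.1.trans haz.lt).trans hz)
      · convert finite_empty
        ext n
        simp only [mem_ofPred_eq, mem_empty_iff_false, iff_false]
        exact fun h => h.2.2 h.1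
      · intro a ha haz
        -- Strictness holds because a is not a value of `r`; hence only finitely many records
        -- diverted to z fail to exceed `r m`.
        have hma : r m < a :=
          lt_of_le_of_ne (haz.le_of_lt hz) fun h => (hS ha).1 ⟨m, h⟩
        exact (finite_recordsBelow_le hr (hS ha) hma).subset fun n hn => ⟨hn.1, not_lt.1 hn.2⟩
      · refine disjoint_left.2 fun z hz hz' => ?_
        rcases cases z with ⟨n, rfl⟩ | ⟨x, rfl⟩
        · exact lt_asymm (α := L) hz hz'
        · exact lt_asymm (α := L) hz hz'
  refine ⟨fun z w hzw => ?_⟩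
  rcases cases z with ⟨n, rfl⟩ | ⟨x, rfl⟩
  · exact hnat n w hzw
  rcases cases w with ⟨n, rfl⟩ | ⟨y, rfl⟩
  · obtain ⟨u, v, hu, hv, h1, h2, hd⟩ := hnat n _ hzw.symm
    exact ⟨v, u, hv, hu, h2, h1, hd.symm⟩
  rcases lt_or_gt_of_ne fun h : x = y => hzw (h ▸ rfl) with h | h
  · exact hpt x y h
  · obtain ⟨u, v, hu, hv, h1, h2, hd⟩ := hpt y x h
    exact ⟨v, u, hv, hu, h2, h1, hd.symm⟩

theorem isOmegaCompactification [CompactSpace L] (hr : DenseRange r)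
    (hinf : ∀ n, {m | r m = r n}.Infinite) (hS : S ⊆ missedJumps r) :
    IsOmegaCompactification (nat : ℕ → ShiftedSum r S) where
  compact := compactSpace hS
  hausdorff := t2Space hr hS
  denseEmbedding :=
    { isOpenEmbedding_nat.toIsEmbedding with dense := denseRange_nat hr hinf hS }

theorem nonempty_homeomorph_omegaRemainder [CompactSpace L] (hr : DenseRange r)
    (hS : S ⊆ missedJumps r) :
    Nonempty (omegaRemainder (nat : ℕ → ShiftedSum r S) ≃ₜ L) := by
  have := t2Space hr hS
  have h : Topology.IsEmbedding (pt : L → ShiftedSum r S) :=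
    (continuous_pt.isClosedEmbedding pt_injective).toIsEmbedding
  exact ⟨(Homeomorph.setCongr compl_range_nat).trans h.toHomeomorph.symm⟩

end ShiftedSum

end Splitting

/-! ### Counting functions of bounded variation. -/

section BoundedVariationCardinality

variable {J : Type u} [LinearOrder J] {U : ℕ → Set J}

theorem Cardinal.mk_le_continuum_of_separating
    (hsep : ∀ a b, a < b → ∃ n, a ∉ U n ∧ b ∈ U n) : #J ≤ 𝔠 := by
  have hinj : Function.Injective fun a : J => {n | a ∈ U n} := by
    intro a b hab
    have hab' : ∀ n, a ∈ U n ↔ b ∈ U n := fun n => Set.ext_iff.1 hab n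
    rcases lt_trichotomy a b with h | h | h
    · obtain ⟨n, hn, hn'⟩ := hsep a b h
      exact absurd ((hab' n).2 hn') hn
    · exact h
    · obtain ⟨n, hn, hn'⟩ := hsep b a h
      exact absurd ((hab' n).1 hn') hn
  simpa using Cardinal.lift_mk_le_lift_mk_of_injective hinj

/-- A lower set is determined by its greatest element or, failing one, by the indices n for which `U
n` meets it: a belongs to it exactly when some such `U n` omits a. -/
theorem LowerSet.mk_le_continuum (hU : ∀ n, IsUpperSet (U n))
    (hsep : ∀ a b, a < b → ∃ n, a ∉ U n ∧ b ∈ U n) : #(LowerSet J) ≤ 𝔠 := by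
  classical
  let φ : LowerSet J → J ⊕ Set ℕ := fun s =>
    if h : ∃ a, IsGreatest (s : Set J) a then Sum.inl h.choose
    else Sum.inr {n | ∃ a ∈ s, a ∈ U n}
  have hmax : ∀ (s : LowerSet J) (h : ∃ a, IsGreatest (s : Set J) a), s = LowerSet.Iic h.choose := by
    intro s h
    ext a
    exact ⟨fun ha => h.choose_spec.2 ha, fun ha => s.lower ha h.choose_spec.1⟩
  have hnomax : ∀ s : LowerSet J, (¬ ∃ a, IsGreatest (s : Set J) a) →
      ∀ a, a ∈ s ↔ ∃ n, a ∉ U n ∧ ∃ b ∈ s, b ∈ U n := by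
    intro s h a
    constructor
    · intro ha
      have : ∃ b ∈ s, a < b := by
        by_contra! h'
        exact h ⟨a, ha, h'⟩
      obtain ⟨b, hb, hab⟩ := this
      obtain ⟨n, hn, hn'⟩ := hsep a b hab
      exact ⟨n, hn, b, hb, hn'⟩
    · rintro ⟨n, hn, b, hb, hbn⟩
      exact s.lower (not_lt.1 fun hlt => hn (hU n hlt.le hbn)) hb
  have hφ : Function.Injective φ := by
    intro s t hst
    by_cases hs : ∃ a, IsGreatest (s : Set J) a <;> by_cases ht : ∃ a, IsGreatest (t : Set J) a
    · simp only [φ, dif_pos hs, dif_pos ht, Sum.inl.injEq] at hst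
      rw [hmax s hs, hmax t ht, hst]
    · simp [φ, dif_pos hs, dif_neg ht] at hst
    · simp [φ, dif_neg hs, dif_pos ht] at hst
    · simp only [φ, dif_neg hs, dif_neg ht, Sum.inr.injEq] at hst
      ext a
      change a ∈ s ↔ a ∈ t
      rw [hnomax s hs, hnomax t ht]
      exact exists_congr fun n => and_congr_right fun _ => Set.ext_iff.1 hst n
  refine (Cardinal.mk_le_of_injective hφ).trans ?_
  have hJ := Cardinal.mk_le_continuum_of_separating hsep
  rw [Cardinal.mk_sum]
  refine (add_le_add (by simpa using hJ) (?_ : _ ≤ 𝔠)).trans Cardinal.continuum_add_self.le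
  simp

/-- A monotone function is determined by its lower sets {m < q} with q rational, and 𝔠^ℵ₀ = 𝔠. -/
theorem Cardinal.mk_monotone_real_le_continuum (hU : ∀ n, IsUpperSet (U n))
    (hsep : ∀ a b, a < b → ∃ n, a ∉ U n ∧ b ∈ U n) : #{m : J → ℝ // Monotone m} ≤ 𝔠 := by
  let φ : {m : J → ℝ // Monotone m} → (ℚ → LowerSet J) := fun m q =>
    ⟨{a | m.1 a < q}, fun _ _ hba ha => (m.2 hba).trans_lt ha⟩
  have hφ : Function.Injective φ := by
    intro m m' h
    have key : ∀ a (q : ℚ), m.1 a < q ↔ m'.1 a < q := fun a q =>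
      Set.ext_iff.1 (congrArg (fun s : LowerSet J => (s : Set J)) (congrFun h q)) a
    refine Subtype.ext (funext fun a => ?_)
    rcases lt_trichotomy (m.1 a) (m'.1 a) with h | h | h
    · obtain ⟨q, h1, h2⟩ := exists_rat_btwn h
      exact absurd ((key a q).1 h1) h2.not_gt
    · exact h
    · obtain ⟨q, h1, h2⟩ := exists_rat_btwn h
      exact absurd ((key a q).2 h1) h2.not_gt
  refine (Cardinal.mk_le_of_injective hφ).trans ?_
  rw [Cardinal.mk_arrow]
  refine (Cardinal.power_le_power_right (by simpa using LowerSet.mk_le_continuum hU hsep)).trans ?_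
  simp

theorem Cardinal.mk_boundedVariationOn_le_continuum (hU : ∀ n, IsUpperSet (U n))
    (hsep : ∀ a b, a < b → ∃ n, a ∉ U n ∧ b ∈ U n) :
    #{g : J → ℝ // BoundedVariationOn g Set.univ} ≤ 𝔠 := by
  choose p q hp hq h using fun g : {g : J → ℝ // BoundedVariationOn g Set.univ} =>
    g.2.locallyBoundedVariationOn.exists_monotoneOn_sub_monotoneOn
  let φ : {g : J → ℝ // BoundedVariationOn g Set.univ} →
      {m : J → ℝ // Monotone m} × {m : J → ℝ // Monotone m} := fun g =>
    (⟨p g, monotoneOn_univ.1 (hp g)⟩, ⟨q g, monotoneOn_univ.1 (hq g)⟩)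
  have hφ : Function.Injective φ := by
    intro g g' hg
    simp only [φ, Prod.mk.injEq, Subtype.mk.injEq] at hg
    exact Subtype.ext (by rw [h g, h g', hg.1, hg.2])
  have hm := Cardinal.mk_monotone_real_le_continuum hU hsep
  refine (Cardinal.mk_le_of_injective hφ).trans ?_
  rw [← Cardinal.mul_def]
  exact (mul_le_mul' hm hm).trans Cardinal.continuum_mul_self.le

end BoundedVariationCardinality

/-! ### The weight is controlled by the missed jumps. -/

section Weight

variable {L : Type u} [LinearOrder L] [TopologicalSpace L] [OrderTopology L] {r : ℕ → L}

/-- The open rays with endpoints in `E` form a subbasis if `E` contains a dense set and all the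
endpoints of jumps. -/
theorem OrderTopology.eq_generateFrom_of_covBy {E : Set L} (hr : DenseRange r)
    (hrE : range r ⊆ E) (hcov : ∀ a b : L, a ⋖ b → a ∈ E ∧ b ∈ E) :
    (inferInstance : TopologicalSpace L) = generateFrom (Iio '' E ∪ Ioi '' E) := by
  refine le_antisymm (le_generateFrom ?_) ?_
  · rintro _ (⟨x, -, rfl⟩ | ⟨x, -, rfl⟩)
    exacts [isOpen_Iio, isOpen_Ioi]
  rw [OrderTopology.topology_eq_generate_intervals (α := L)]
  refine le_generateFrom ?_
  rintro _ ⟨y, rfl | rfl⟩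
  · have : Ioi y = ⋃ x ∈ {x ∈ E | y ≤ x}, Ioi x := by
      ext z
      simp only [mem_Ioi, mem_iUnion, mem_ofPred_eq, exists_prop]
      constructor
      · intro hyz
        by_cases h : y ⋖ z
        · exact ⟨y, ⟨(hcov y z h).1, le_rfl⟩, hyz⟩
        · obtain ⟨n, h1, h2⟩ := hr.exists_between_of_not_covBy hyz h
          exact ⟨r n, ⟨hrE ⟨n, rfl⟩, h1.le⟩, h2⟩
      · rintro ⟨x, ⟨-, hyx⟩, hxz⟩
        exact hyx.trans_lt hxz
    rw [this]
    exact @isOpen_biUnion _ _ (generateFrom _) _ _ fun x hx =>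
      isOpen_generateFrom_of_mem (Or.inr ⟨x, hx.1, rfl⟩)
  · have : Iio y = ⋃ x ∈ {x ∈ E | x ≤ y}, Iio x := by
      ext z
      simp only [mem_Iio, mem_iUnion, mem_ofPred_eq, exists_prop]
      constructor
      · intro hzy
        by_cases h : z ⋖ y
        · exact ⟨y, ⟨(hcov z y h).2, le_rfl⟩, hzy⟩
        · obtain ⟨n, h1, h2⟩ := hr.exists_between_of_not_covBy hzy h
          exact ⟨r n, ⟨hrE ⟨n, rfl⟩, h2.le⟩, h1⟩
      · rintro ⟨x, ⟨-, hxy⟩, hzx⟩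
        exact hzx.trans_le hxy
    rw [this]
    exact @isOpen_biUnion _ _ (generateFrom _) _ _ fun x hx =>
      isOpen_generateFrom_of_mem (Or.inl ⟨x, hx.1, rfl⟩)

theorem topWeight_le_of_generateFrom {X : Type u} [t : TopologicalSpace X] {s : Set (Set X)}
    (h : t = generateFrom s) {c : Cardinal.{u}} (hc : ℵ₀ ≤ c) (hs : #s ≤ c) :
    topWeight X ≤ c := by
  refine (csInf_le' ⟨_, isTopologicalBasis_of_subbasis h, rfl⟩ : topWeight X ≤ _).trans ?_
  -- Finite intersections are indexed by lists, of which there are at most max(ℵ₀, #s).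
  let ψ : List s → Set X := fun l => ⋂₀ {u | ∃ v ∈ l, (v : Set X) = u}
  have : (fun f : Set (Set X) => ⋂₀ f) '' {f | f.Finite ∧ f ⊆ s} ⊆ range ψ := by
    rintro _ ⟨f, ⟨hf, hfs⟩, rfl⟩
    lift f to Finset (Set X) using hf
    refine ⟨f.attach.toList.map fun v => ⟨v.1, hfs v.2⟩, ?_⟩
    simp only [ψ]
    congr 1
    ext u
    simpa using fun hu => hfs hu
  refine (Cardinal.mk_le_mk_of_subset this).trans (Cardinal.mk_range_le.trans ?_)
  exact (Cardinal.mk_list_le_max _).trans (max_le hc hs)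

theorem topWeight_le_max_mk_missedJumps (hr : DenseRange r) :
    topWeight L ≤ max ℵ₀ #(missedJumps r) := by
  classical
  let P : Set L := range r ∪ missedJumps r
  -- The successor map, with an irrelevant default off the jumps: right endpoints of jumps are its
  -- values at left endpoints, so they do not raise the cardinality.
  let f : L → L := fun a => if h : ∃ b, a ⋖ b then h.choose else a
  have hf : ∀ {a b}, a ⋖ b → f a = b := fun {a b} h => by
    have h' : ∃ b, a ⋖ b := ⟨b, h⟩
    simp only [f, dif_pos h']
    exact h'.choose_spec.unique_right h
  let E : Set L := P ∪ f '' P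
  have hE : (inferInstance : TopologicalSpace L) = generateFrom (Iio '' E ∪ Ioi '' E) := by
    refine OrderTopology.eq_generateFrom_of_covBy hr
      (fun x hx => Or.inl (Or.inl hx)) fun a b hab => ?_
    have ha : a ∈ P := by
      by_cases h : a ∈ range r
      · exact Or.inl h
      · exact Or.inr ⟨h, b, hab⟩
    exact ⟨Or.inl ha, Or.inr ⟨a, ha, hf hab⟩⟩
  set c := max ℵ₀ #(missedJumps r)
  have hc0 : ℵ₀ ≤ c := le_max_left _ _
  have hadd : ∀ {x y : Cardinal.{u}}, x ≤ c → y ≤ c → x + y ≤ c := fun hx hy =>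
    Cardinal.add_le_of_le hc0 hx hy
  have hP : #P ≤ c := (Cardinal.mk_union_le _ _).trans
    (hadd (((countable_range r).le_aleph0).trans hc0) (le_max_right _ _))
  have hEc : #E ≤ c := (Cardinal.mk_union_le _ _).trans (hadd hP (Cardinal.mk_image_le.trans hP))
  exact topWeight_le_of_generateFrom hE hc0 ((Cardinal.mk_union_le _ _).trans
    (hadd (Cardinal.mk_image_le.trans hEc) (Cardinal.mk_image_le.trans hEc)))

end Weight

/-! ### The copy of c₀ in C(γω) and the induced twisted sum. -/

section OmegaCompactification

open Filter Topology

variable {γ : Type u} [TopologicalSpace γ] {ι : ℕ → γ}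

namespace IsOmegaCompactification

theorem isOpen_singleton (h : IsOmegaCompactification ι) (n : ℕ) : IsOpen ({ι n} : Set γ) := by
  have := h.hausdorff
  obtain ⟨U, hU, hUn⟩ := h.denseEmbedding.isInducing.isOpen_iff.1 (isOpen_discrete ({n} : Set ℕ))
  have hmem : ι n ∈ U := by
    have : n ∈ ι ⁻¹' U := hUn ▸ rfl
    exact this
  have hV : IsOpen (U \ {ι n}) := hU.sdiff isClosed_singleton
  have : U = {ι n} := by
    refine Subset.antisymm (fun x hx => ?_) (singleton_subset_iff.2 hmem)
    by_contra hxn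
    obtain ⟨m, hm⟩ := h.denseEmbedding.dense.exists_mem_open hV ⟨x, hx, hxn⟩
    have hm' : m ∈ ι ⁻¹' U := hm.1
    rw [hUn] at hm'
    exact hm.2 (congrArg ι hm')
  exact this ▸ hU

theorem isClosed_omegaRemainder (h : IsOmegaCompactification ι) : IsClosed (omegaRemainder ι) := by
  refine isClosed_compl_iff.2 ?_
  rw [← iUnion_singleton_eq_range]
  exact isOpen_iUnion h.isOpen_singleton

theorem finite_preimage_of_disjoint (h : IsOmegaCompactification ι) {K : Set γ} (hK : IsClosed K)
    (hd : Disjoint K (omegaRemainder ι)) : (ι ⁻¹' K).Finite := by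
  have := h.compact
  have hKr : K ⊆ range ι := disjoint_compl_right_iff_subset.1 hd
  exact ((h.denseEmbedding.isEmbedding.isInducing.isCompact_preimage_iff hKr).2
    hK.isCompact).finite_of_discrete

theorem tendsto_zero_of_mem_naturalCZero (h : IsOmegaCompactification ι) {f : C(γ, ℝ)}
    (hf : f ∈ naturalCZero ι) : Tendsto (fun n => f (ι n)) cofinite (𝓝 0) := by
  refine Metric.tendsto_nhds.2 fun ε hε => ?_
  have hK : IsClosed {x | ε ≤ |f x|} := isClosed_le continuous_const (by fun_prop)
  have hfin := h.finite_preimage_of_disjoint hK (disjoint_left.2 fun x hx hxr => by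
    have h0 : f x = 0 := hf x hxr
    have h1 : ε ≤ |f x| := hx
    rw [h0, abs_zero] at h1
    exact absurd h1 (not_le.2 hε))
  refine hfin.subset fun n hn => ?_
  simpa [Real.dist_eq] using hn

/-- Extension by zero of null sequences, as a map from `c₀` to `C(γω)`. -/
noncomputable def extendCLM (h : IsOmegaCompactification ι) [CompactSpace γ] :
    C₀(ℕ, ℝ) →L[ℝ] C(γ, ℝ) :=
  have hinj := h.denseEmbedding.injective
  have hcont : ∀ f : C₀(ℕ, ℝ), Continuous (Function.extend ι f 0) := fun f => by
    refine continuous_iff_continuousAt.2 fun x => ?_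
    by_cases hx : x ∈ range ι
    · obtain ⟨n, rfl⟩ := hx
      exact continuousAt_of_tendsto_nhds (y := f n) (by
        rw [isOpen_singleton_iff_nhds_eq_pure (ι n) |>.1 (h.isOpen_singleton n)]
        refine tendsto_pure_left.2 fun s hs => ?_
        rw [hinj.extend_apply]
        exact mem_of_mem_nhds hs)
    · have h0 : Function.extend ι f 0 x = 0 := Function.extend_apply' _ _ _ hx
      rw [ContinuousAt, h0]
      refine Metric.tendsto_nhds.2 fun ε hε => ?_
      have hf : Tendsto f cofinite (𝓝 0) := by
        have := f.zero_at_infty'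
        rwa [cocompact_eq_cofinite] at this
      have hfin : {n | ¬ dist (f n) 0 < ε}.Finite := Metric.tendsto_nhds.1 hf ε hε
      have := h.hausdorff
      have hcl : IsClosed (ι '' {n | ¬ dist (f n) 0 < ε}) := (hfin.image ι).isClosed
      filter_upwards [hcl.isOpen_compl.mem_nhds fun ⟨n, _, hn⟩ => hx ⟨n, hn⟩] with y hy
      by_cases hyr : y ∈ range ι
      · obtain ⟨n, rfl⟩ := hyr
        rw [hinj.extend_apply]
        by_contra hn
        exact hy ⟨n, hn, rfl⟩
      · rw [Function.extend_apply' _ _ _ hyr]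
        simpa using hε
  LinearMap.mkContinuous
    { toFun := fun f => ⟨Function.extend ι f 0, hcont f⟩
      map_add' := fun f g => by
        ext x
        by_cases hx : x ∈ range ι
        · obtain ⟨n, rfl⟩ := hx
          simp [hinj.extend_apply]
        · simp [Function.extend_apply' _ _ _ hx]
      map_smul' := fun c f => by
        ext x
        by_cases hx : x ∈ range ι
        · obtain ⟨n, rfl⟩ := hx
          simp [hinj.extend_apply]
        · simp [Function.extend_apply' _ _ _ hx] } 1 fun f => by
    rw [one_mul, ContinuousMap.norm_le _ (norm_nonneg f)]
    intro x
    by_cases hx : x ∈ range ι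
    · obtain ⟨n, rfl⟩ := hx
      simpa [hinj.extend_apply] using f.toBCF.norm_coe_le_norm n
    · simp [Function.extend_apply' _ _ _ hx]

theorem extendCLM_apply (h : IsOmegaCompactification ι) [CompactSpace γ] (f : C₀(ℕ, ℝ)) (n : ℕ) :
    h.extendCLM f (ι n) = f n :=
  h.denseEmbedding.injective.extend_apply _ _ n

theorem extendCLM_mem_naturalCZero (h : IsOmegaCompactification ι) [CompactSpace γ]
    (f : C₀(ℕ, ℝ)) : h.extendCLM f ∈ naturalCZero ι :=
  fun _ hx => Function.extend_apply' _ _ _ hx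

theorem exists_extendCLM_eq (h : IsOmegaCompactification ι) [CompactSpace γ] {f : C(γ, ℝ)}
    (hf : f ∈ naturalCZero ι) : ∃ g, h.extendCLM g = f := by
  refine ⟨⟨⟨fun n => f (ι n), continuous_of_discreteTopology⟩, ?_⟩, ?_⟩
  · rw [cocompact_eq_cofinite]
    exact h.tendsto_zero_of_mem_naturalCZero hf
  · ext x
    by_cases hx : x ∈ range ι
    · obtain ⟨n, rfl⟩ := hx
      exact h.extendCLM_apply _ n
    · rw [hf x hx]
      exact h.extendCLM_mem_naturalCZero _ x hx

end IsOmegaCompactification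

/-- The sequence is extension by zero followed by restriction to the remainder, which is onto by
Tietze's theorem. A left inverse of the extension, composed with it, would project onto the natural
copy of c₀. -/
theorem HasNonTameCompactification.hasNontrivialTwistedSum {L : Type u} [TopologicalSpace L]
    [CompactSpace L] (hL : HasNonTameCompactification L) :
    HasNontrivialTwistedSum C₀(ℕ, ℝ) C(L, ℝ) := by
  obtain ⟨γ, _, ι, h, ⟨e⟩, hnt⟩ := hL
  have := h.compact
  have := h.hausdorff
  let j : C(L, γ) := ⟨fun x => (e.symm x : γ), by fun_prop⟩
  refine ⟨C(γ, ℝ), inferInstance, inferInstance, inferInstance, h.extendCLM,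
    ContinuousLinearMap.mk (ContinuousMap.compRightAlgHom ℝ ℝ j).toLinearMap
      (ContinuousMap.continuous_precomp j), ⟨?_, ?_, ?_⟩, ?_⟩
  · intro f g hfg
    ext n
    rw [← h.extendCLM_apply, hfg, h.extendCLM_apply]
  · intro f
    constructor
    · intro hf
      refine h.exists_extendCLM_eq fun x hx => ?_
      have := DFunLike.congr_fun hf (e ⟨x, hx⟩)
      rw [show f x = f (j (e ⟨x, hx⟩)) by simp [j]]
      exact this
    · rintro ⟨g, rfl⟩
      ext x
      exact h.extendCLM_mem_naturalCZero g _ (e.symm x).2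
  · intro g
    obtain ⟨f, hf⟩ := ContinuousMap.exists_restrict_eq h.isClosed_omegaRemainder
      (g.comp ⟨e, e.continuous⟩)
    refine ⟨f, ?_⟩
    ext x
    have := DFunLike.congr_fun hf (e.symm x)
    change f (e.symm x) = g x
    simpa using this
  · rintro ⟨ρ, hρ⟩
    refine hnt ⟨(h.extendCLM.comp ρ).codRestrict (naturalCZero ι)
      fun f => h.extendCLM_mem_naturalCZero _, ?_⟩
    rintro ⟨f, hf⟩
    obtain ⟨g, rfl⟩ := h.exists_extendCLM_eq hf
    refine Subtype.ext ?_
    exact congrArg h.extendCLM (DFunLike.congr_fun hρ g : ρ (h.extendCLM g) = g)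

/-! ### Bounded variation of the coordinates of an operator. -/

section Variation

variable [CompactSpace γ]

/-- The values of an operator killing the functions that vanish on the remainder are controlled by
the values of the function on the remainder. -/
theorem abs_apply_le_norm_of_forall_omegaRemainder (Q : C(γ, ℝ) →L[ℝ] C(γ, ℝ))
    (hQ : ∀ f ∈ naturalCZero ι, Q f = 0) {f : C(γ, ℝ)}
    (hf : ∀ x ∈ omegaRemainder ι, |f x| ≤ 1) (x : γ) : |Q f x| ≤ ‖Q‖ := by
  -- Truncation leaves f unchanged on the remainder, hence leaves Qf unchanged, and brings the norm
  -- down to 1.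
  let g : C(γ, ℝ) := ⟨fun x => max (-1) (min 1 (f x)), by fun_prop⟩
  have hg : ‖g‖ ≤ 1 := (ContinuousMap.norm_le _ zero_le_one).2 fun x =>
    abs_le.2 ⟨le_max_left _ _, max_le (by norm_num) (min_le_left _ _)⟩
  have hfg : Q f = Q g := by
    rw [← sub_eq_zero, ← map_sub]
    refine hQ _ fun x hx => ?_
    obtain ⟨h1, h2⟩ := abs_le.1 (hf x hx)
    simp [g, min_eq_right h2, max_eq_right h1]
  rw [hfg]
  calc |Q g x| ≤ ‖Q g‖ := (Q g).norm_coe_le_norm x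
    _ ≤ ‖Q‖ * ‖g‖ := Q.le_opNorm g
    _ ≤ ‖Q‖ := mul_le_of_le_one_right Q.opNorm_nonneg hg

theorem boundedVariationOn_of_monotone_on_omegaRemainder {J : Type v} [LinearOrder J]
    (Q : C(γ, ℝ) →L[ℝ] C(γ, ℝ)) (hQ : ∀ f ∈ naturalCZero ι, Q f = 0) {F : J → C(γ, ℝ)}
    (hF : ∀ x ∈ omegaRemainder ι, Monotone fun a => F a x)
    (hF01 : ∀ a, ∀ x ∈ omegaRemainder ι, F a x ∈ Icc (0 : ℝ) 1) (x : γ) :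
    BoundedVariationOn (fun a => Q (F a) x) Set.univ := by
  refine ne_top_of_le_ne_top (ENNReal.ofReal_ne_top (r := ‖Q‖)) (iSup_le ?_)
  rintro ⟨n, u, hu, -⟩
  simp only [edist_dist, Real.dist_eq]
  rw [← ENNReal.ofReal_sum_of_nonneg fun _ _ => abs_nonneg _]
  refine ENNReal.ofReal_le_ofReal ?_
  -- With these signs Qf(x) is exactly the variation sum, while on the remainder |f| is dominated by
  -- a telescoping sum of nonnegative increments, at most 1.
  let s : ℕ → ℝ := fun i => SignType.sign (Q (F (u (i + 1))) x - Q (F (u i)) x)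
  let f : C(γ, ℝ) := ∑ i ∈ Finset.range n, s i • (F (u (i + 1)) - F (u i))
  have hs : ∀ i, |s i| ≤ 1 := fun i => by
    simp only [s]
    rcases SignType.trichotomy (SignType.sign (Q (F (u (i + 1))) x - Q (F (u i)) x)) with
      h | h | h <;> simp [h]
  have hf : ∀ y ∈ omegaRemainder ι, |f y| ≤ 1 := by
    intro y hy
    calc |f y| = |∑ i ∈ Finset.range n, s i * (F (u (i + 1)) y - F (u i) y)| := by
          simp [f, ContinuousMap.sum_apply]
      _ ≤ ∑ i ∈ Finset.range n, |s i * (F (u (i + 1)) y - F (u i) y)| :=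
          Finset.abs_sum_le_sum_abs _ _
      _ ≤ ∑ i ∈ Finset.range n, (F (u (i + 1)) y - F (u i) y) := by
          refine Finset.sum_le_sum fun i _ => ?_
          have h0 : 0 ≤ F (u (i + 1)) y - F (u i) y := sub_nonneg.2 (hF y hy (hu i.le_succ))
          rw [abs_mul, abs_of_nonneg h0]
          exact mul_le_of_le_one_left h0 (hs i)
      _ = F (u n) y - F (u 0) y := Finset.sum_range_sub (fun i => F (u i) y) n
      _ ≤ 1 := by linarith [(hF01 (u n) y hy).2, (hF01 (u 0) y hy).1]
  refine le_trans (le_of_eq ?_)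
    ((le_abs_self _).trans (abs_apply_le_norm_of_forall_omegaRemainder Q hQ hf x))
  simp only [f, map_sum, map_smul, map_sub, ContinuousMap.sum_apply, ContinuousMap.smul_apply,
    ContinuousMap.sub_apply, smul_eq_mul, s, sign_mul_self]

end Variation

end OmegaCompactification

/-! ### The counting argument. -/

namespace ShiftedSum

open Filter Topology

variable {L : Type u} [LinearOrder L] [TopologicalSpace L] [OrderTopology L] {r : ℕ → L}
  {S : Set L}

/-- The indicator function of `cut r S a`. -/
noncomputable def cutIndicator (hr : DenseRange r) (hS : S ⊆ missedJumps r) (a : missedJumps r) :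
    C(ShiftedSum r S, ℝ) where
  toFun := (cut r S a).indicator 1
  continuous_toFun := by
    obtain ⟨b, hb⟩ := a.2.2
    exact continuous_one.indicator (by simp [(isClopen_cut hr hS hb).frontier_eq])

theorem cutIndicator_apply (hr : DenseRange r) (hS : S ⊆ missedJumps r) (a : missedJumps r)
    (z : ShiftedSum r S) : cutIndicator hr hS a z = (cut r S a).indicator 1 z := rfl

/-- For a projection P onto the copy of c₀ and Q = 1 - P, take as `G n` the n-th coordinate of Q on
the cut indicators. The error is -P of an indicator, hence null. -/
theorem exists_coordinates_of_isTame [CompactSpace L] (hr : DenseRange r)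
    (hinf : ∀ n, {m | r m = r n}.Infinite) (hS : S ⊆ missedJumps r)
    (ht : IsTameCompactification (nat : ℕ → ShiftedSum r S)) :
    ∃ G : ℕ → {g : missedJumps r → ℝ // BoundedVariationOn g Set.univ}, ∀ a,
      Tendsto (fun n => (G n).1 a - cutIndicator hr hS a (nat n)) cofinite (𝓝 0) := by
  have h := isOmegaCompactification hr hinf hS
  have := h.compact
  obtain ⟨P, hP⟩ := ht
  let Q : C(ShiftedSum r S, ℝ) →L[ℝ] C(ShiftedSum r S, ℝ) :=
    ContinuousLinearMap.id ℝ _ - (naturalCZero nat).subtypeL.comp P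
  have hQ : ∀ f ∈ naturalCZero (nat : ℕ → ShiftedSum r S), Q f = 0 := fun f hf => by
    simp [Q, hP ⟨f, hf⟩]
  have hpt : ∀ z ∈ omegaRemainder (nat : ℕ → ShiftedSum r S), ∃ x, pt x = z := fun z hz => by
    rwa [omegaRemainder, compl_range_nat] at hz
  refine ⟨fun n => ⟨fun a => Q (cutIndicator hr hS a) (nat n),
    boundedVariationOn_of_monotone_on_omegaRemainder Q hQ ?_ ?_ _⟩, fun a => ?_⟩
  · intro z hz a b hab
    obtain ⟨x, rfl⟩ := hpt z hz
    have hmem : ∀ c : missedJumps r, (pt x : ShiftedSum r S) ∈ cut r S c ↔ x ≤ c := fun _ => Iff.rfl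
    by_cases hx : x ≤ a
    · simp [cutIndicator_apply, hmem, hx, hx.trans hab]
    · simp only [cutIndicator_apply, indicator_of_notMem (mt (hmem a).1 hx)]
      exact indicator_nonneg (fun _ _ => zero_le_one) _
  · intro a z _
    rw [cutIndicator_apply]
    by_cases hz : z ∈ cut r S a <;> simp [hz]
  · have := (h.tendsto_zero_of_mem_naturalCZero (P (cutIndicator hr hS a)).2).neg
    simpa [Q] using this

theorem exists_not_isTame [CompactSpace L] (hr : DenseRange r)
    (hinf : ∀ n, {m | r m = r n}.Infinite) (hc : 𝔠 < 2 ^ #(missedJumps r)) :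
    ∃ S ⊆ missedJumps r, ¬ IsTameCompactification (nat : ℕ → ShiftedSum r S) := by
  by_contra! htame
  have hS : ∀ S : Set (missedJumps r), Subtype.val '' S ⊆ missedJumps r := fun S => by
    rintro _ ⟨a, -, rfl⟩
    exact a.2
  choose G hG using fun S : Set (missedJumps r) =>
    exists_coordinates_of_isTame hr hinf (hS S) (htame _ (hS S))
  have hle : ∀ S T, G S = G T → S ⊆ T := by
    intro S T hST a haS
    by_contra haT
    -- Equal coordinates make the two cut indicators at a differ by a null sequence, yet they differ
    -- by 1 at each of the infinitely many records below a.
    have hlim := (hG S a).sub (hG T a)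
    rw [hST, sub_zero] at hlim
    have hfin : {n | ¬ dist _ (0 : ℝ) < 1}.Finite := Metric.tendsto_nhds.1 hlim 1 one_pos
    refine infinite_recordsBelow hr a.2 (hfin.subset fun n hn => ?_)
    have h1 : (nat n : ShiftedSum r (Subtype.val '' S)) ∉ cut r (Subtype.val '' S) a :=
      fun h => h.2 ⟨a, haS, rfl⟩ hn
    have h2 : (nat n : ShiftedSum r (Subtype.val '' T)) ∈ cut r (Subtype.val '' T) a :=
      ⟨hn.1.le, fun ⟨b, hb, hba⟩ => absurd (Subtype.ext hba ▸ hb) haT⟩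
    simp [cutIndicator_apply, h1, h2]
  have hinj : Function.Injective G := fun S T h =>
    Subset.antisymm (hle S T h) (hle T S h.symm)
  have hcard := Cardinal.mk_le_of_injective hinj
  have hbv := Cardinal.mk_boundedVariationOn_le_continuum (J := missedJumps r)
    (U := fun n => {a | r n < a}) (fun n a b hab ha => lt_of_lt_of_le ha hab) fun a b hab => by
      obtain ⟨n, h1, h2⟩ := hr.exists_between_of_mem_missedJumps b.2 hab
      exact ⟨n, not_lt.2 h1.le, h2⟩
  rw [Cardinal.mk_set, Cardinal.mk_arrow] at hcard
  refine absurd (hcard.trans ?_) (not_le.2 hc)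
  refine (Cardinal.power_le_power_right (by simpa using hbv)).trans ?_
  simp

end ShiftedSum

theorem hasNonTameCompactification_of_continuum_lt (L : Type u) [LinearOrder L]
    [TopologicalSpace L] [OrderTopology L] [CompactSpace L] [SeparableSpace L]
    (hL : Cardinal.continuum.{u} < 2 ^ topWeight L) : HasNonTameCompactification L := by
  rcases isEmpty_or_nonempty L with hE | hE
  · have h0 : topWeight L = 0 := by
      refine nonpos_iff_eq_zero.1 ((csInf_le' ⟨∅, ?_, rfl⟩ : topWeight L ≤ _).trans (by simp))
      exact isTopologicalBasis_of_isOpen_of_nhds (by simp) fun a => isEmptyElim a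
    rw [h0, Cardinal.power_zero] at hL
    exact absurd (Cardinal.one_lt_aleph0.trans_le Cardinal.aleph0_le_continuum) hL.not_gt
  -- Unpairing repeats each term of a dense sequence infinitely often.
  let r : ℕ → L := fun n => denseSeq L n.unpair.1
  have hr : DenseRange r := by
    have : range r = range (denseSeq L) :=
      Function.Surjective.range_comp (f := fun n : ℕ => n.unpair.1)
        (fun n => ⟨Nat.pair n 0, by simp⟩) (denseSeq L)
    rw [DenseRange, this]
    exact denseRange_denseSeq L
  have hinf : ∀ n, {m | r m = r n}.Infinite := fun n => by
    refine infinite_of_injective_forall_mem (f := fun k => Nat.pair n.unpair.1 k) ?_ fun k => ?_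
    · intro k l hkl
      simpa using hkl
    · simp [r]
  have hc : 𝔠 < 2 ^ #(missedJumps r) := by
    have hw := topWeight_le_max_mk_missedJumps hr
    -- Countably many missed jumps would give countable weight, and 2^ℵ₀ = 𝔠 contradicts the
    -- hypothesis.
    rcases le_total #(missedJumps r) ℵ₀ with h | h
    · rw [max_eq_left h] at hw
      refine absurd (Cardinal.power_le_power_left two_ne_zero hw) (not_le.2 ?_)
      rwa [Cardinal.two_power_aleph0]
    · rw [max_eq_right h] at hw
      exact hL.trans_le (Cardinal.power_le_power_left two_ne_zero hw)
  obtain ⟨S, hS, hnt⟩ := ShiftedSum.exists_not_isTame hr hinf hc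
  exact ⟨ShiftedSum r S, inferInstance, ShiftedSum.nat,
    ShiftedSum.isOmegaCompactification hr hinf hS,
    ShiftedSum.nonempty_homeomorph_omegaRemainder hr hS, hnt⟩

/-! ### Separability and weight of the double arrow space. -/

namespace DoubleArrow

open Filter Topology

theorem lt_def (p q : DoubleArrow) : p < q ↔
    p.pos < q.pos ∨ p.pos = q.pos ∧ p.side < q.side :=
  Prod.Lex.lt_iff

instance : SeparableSpace DoubleArrow := by
  let D : Set DoubleArrow := {p | ∃ q : ℚ, p.pos = q}
  have hD : D.Countable := by
    choose! f hf using fun p (hp : p ∈ D) => hp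
    refine (mapsTo_univ (fun p => (f p, p.side)) D).countable_of_injOn ?_ countable_univ
    intro p hp q hq h
    rw [Prod.mk.injEq] at h
    exact DoubleArrow.ext (by rw [hf p hp, hf q hq, h.1]) h.2
  refine ⟨D, hD, dense_iff_inter_open.2 fun U hU ⟨p, hp⟩ => ?_⟩
  have hU' := hU.mem_nhds hp
  have hmid : ∀ {x y : ℝ}, 0 ≤ x → y ≤ 1 → x < y → ∃ d ∈ D, x < d.pos ∧ d.pos < y := by
    intro x y hx hy hxy
    obtain ⟨q, h1, h2⟩ := exists_rat_btwn hxy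
    exact ⟨⟨q, false, ⟨hx.trans h1.le, h2.le.trans hy⟩, by simp⟩, ⟨q, rfl⟩, h1, h2⟩
  -- Points of the upper arrow are approximated from the right and those of the lower arrow from the
  -- left, except the least point, which is itself in D.
  by_cases hs : p.side = true
  · have hpm := p.side_mem hs
    obtain ⟨u, hu, hpu⟩ := exists_Ico_subset_of_mem_nhds hU'
      ⟨⟨1, false, by simp, by simp⟩, (lt_def _ _).2 (Or.inl hpm.2)⟩
    have hlt : p.pos < u.pos := by
      rcases (lt_def _ _).1 hu with h | h
      · exact h
      · exact absurd h.2 (by simp [hs])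
    obtain ⟨d, hd, h1, h2⟩ := hmid p.pos_mem.1 u.pos_mem.2 hlt
    exact ⟨d, hpu ⟨((lt_def _ _).2 (Or.inl h1)).le, (lt_def _ _).2 (Or.inl h2)⟩, hd⟩
  · rcases p.pos_mem.1.eq_or_lt with h0 | h0
    · exact ⟨p, hp, 0, by simpa using h0.symm⟩
    obtain ⟨l, hl, hlp⟩ := exists_Ioc_subset_of_mem_nhds hU'
      ⟨⟨0, false, by simp, by simp⟩, (lt_def _ _).2 (Or.inl h0)⟩
    have hlt : l.pos < p.pos := by
      rcases (lt_def _ _).1 hl with h | h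
      · exact h
      · exact absurd h.2 (by simp [hs])
    obtain ⟨d, hd, h1, h2⟩ := hmid l.pos_mem.1 p.pos_mem.2 hlt
    exact ⟨d, hlp ⟨(lt_def _ _).2 (Or.inl h1), ((lt_def _ _).2 (Or.inl h2)).le⟩, hd⟩

/-- Each jump (x,0) < (x,1) with x in (0,1) needs its own basic set, one with greatest element
(x,0). -/
theorem continuum_le_topWeight : 𝔠 ≤ topWeight DoubleArrow := by
  refine le_csInf ⟨_, _, isTopologicalBasis_opens, rfl⟩ ?_
  rintro _ ⟨B, hB, rfl⟩
  let lo : Ioo (0 : ℝ) 1 → DoubleArrow := fun x => ⟨x, false, Ioo_subset_Icc_self x.2, by simp⟩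
  let hi : Ioo (0 : ℝ) 1 → DoubleArrow := fun x => ⟨x, true, Ioo_subset_Icc_self x.2, fun _ => x.2⟩
  have hex : ∀ x, ∃ V ∈ B, lo x ∈ V ∧ V ⊆ Iio (hi x) := fun x =>
    hB.exists_subset_of_mem_open ((lt_def _ _).2 (Or.inr ⟨rfl, by simp [lo, hi]⟩)) isOpen_Iio
  choose V hVB hmem hsub using hex
  have hle : ∀ x y, V x = V y → (x : ℝ) ≤ y := fun x y h => by
    rcases (lt_def _ _).1 (hsub y (h ▸ hmem x)) with h | h
    · exact h.le
    · exact h.1.le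
  have hinj : Function.Injective fun x => (⟨V x, hVB x⟩ : B) := fun x y h => by
    have h' : V x = V y := congrArg Subtype.val h
    exact Subtype.ext (le_antisymm (hle x y h') (hle y x h'.symm))
  rw [← Cardinal.mk_Ioo_real (zero_lt_one : (0 : ℝ) < 1)]
  exact Cardinal.mk_le_of_injective hinj

end DoubleArrow

theorem theorem7p2 :
    (∀ (L : Type u) [LinearOrder L] [TopologicalSpace L] [OrderTopology L] [CompactSpace L]
        [SeparableSpace L],
        Cardinal.continuum.{u} < 2 ^ topWeight L →
          HasNonTameCompactification L ∧ HasNontrivialTwistedSum C₀(ℕ, ℝ) C(L, ℝ)) ∧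
      HasNonTameCompactification DoubleArrow ∧
      HasNontrivialTwistedSum C₀(ℕ, ℝ) C(DoubleArrow, ℝ) := by
  have hDA : HasNonTameCompactification DoubleArrow :=
    hasNonTameCompactification_of_continuum_lt DoubleArrow
      (DoubleArrow.continuum_le_topWeight.trans_lt (Cardinal.cantor _))
  refine ⟨fun L _ _ _ _ _ hL => ?_, hDA, hDA.hasNontrivialTwistedSum⟩
  have h := hasNonTameCompactification_of_continuum_lt L hL
  exact ⟨h, h.hasNontrivialTwistedSum⟩
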